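/- **Setting.** Let $\mathcal N$ be a countably infinite multi-sorted set of names with infinitely many names of each sort. Permutations are the sort-preserving bijections of $\mathcal N$ that move finitely many names. A set $N\subseteq\mathcal N$ supports an object $x$ of a set with a permutation action if every permutation fixing $N$ pointwise fixes $x$; $\operatorname{supp}(x)$ is the least finite supporting set, and $N\# x$ means $N\cap\operatorname{supp}(x)=\emptyset$. A nominal set is a set with a permutation action all of whose members have finite support. For a finite set $N$ of names, $\langle N\rangle x$ is the class of $(N,x)$ under: $(N,x)=_\alpha(N',x')$ iff some permutation $\pi$ fixes $\operatorname{supp}(x)\setminus N$ pointwise and satisfies $\pi\cdot N=N'$, $\pi\cdot x=x'$. A *nominal transition system* consists of nominal sets of states $P,Q$, of state predicates $\varphi$ and of actions $\alpha$; an equivariant relation $P\vdash\varphi$; an equivariant map $\operatorname{bn}$ sending an action $\alpha$ to a finite subset of $\operatorname{supp}(\alpha)$; and an equivariant set of pairs $(P,\langle N\rangle(\alpha,P'))$, each satisfying $N=\operatorname{bn}(\alpha)$. Write $P\xrightarrow{\alpha}P'$ if $(P,\langle\operatorname{bn}(\alpha)\rangle(\alpha,P'))$ is in this set. Let $\mathcal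 F$ be a nominal set of effects, that is, a set of finitely supported functions from states to states that is closed under the permutation action. Let $\mathcal P_{\mathrm{fs}}(\mathcal F)$ be the set of finitely supported subsets of $\mathcal F$, and let $L:\mathrm{act}\times\mathcal P_{\mathrm{fs}}(\mathcal F)\times\mathcal F\to\mathcal P_{\mathrm{fs}}(\mathcal F)$ be equivariant, where $\mathrm{act}$ is the set of actions. **Bisimilarity.** An *$L$-bisimulation* is a family $(R_F)_{F\in\mathcal P_{\mathrm{fs}}(\mathcal F)}$ of symmetric relations on states such that $R_F(P,Q)$ and $f\in F$ imply: 1. if $f(P)\vdash\varphi$ then $f(Q)\vdash\varphi$, for every state predicate $\varphi$; 2. for all $\alpha,P'$ with $\operatorname{bn}(\alpha)\# f(Q),F,f$ there is $Q'$ such that, if $f(P)\xrightarrow{\alpha}P'$, then $f(Q)\xrightarrow{\alpha}Q'$ and $R_{L(\alpha,F,f)}(P',Q')$. States $P,Q$ are *$F/L$-bisimilar*, written $P\overset{F/L}{\sim}Q$, if $R_F(P,Q)$ for some $L$-bisimulation $(R_F)$. **Logic.** Fix a cardinal $\kappa$ with $\kappa>\aleph_0$ and $\kappa>|\mathrm{states}|$.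 The sets of formulas $\mathcal A^{F/L}$, $F\in\mathcal P_{\mathrm{fs}}(\mathcal F)$, are defined by mutual induction: $$A^{F/L}::=\bigwedge_{i\in I}A_i^{F/L}\ \mid\ \neg A^{F/L}\ \mid\ \langle f\rangle\varphi\ \mid\ \langle f\rangle\langle\alpha\rangle A^{L(\alpha,F,f)/L},$$ where $f\in F$ and $\operatorname{bn}(\alpha)\# f,F$, and where the set of conjuncts $\{A_i\mid i\in I\}$ has cardinality less than $\kappa$ and finite support. Formulas are taken up to alpha-equivalence, $\langle\alpha\rangle A$ standing for the abstraction of $\operatorname{bn}(\alpha)$ in $(\alpha,A)$. Validity $P\models A$ is the usual one for conjunction and negation; $P\models\langle f\rangle\varphi$ iff $f(P)\vdash\varphi$; and $P\models\langle f\rangle\langle\alpha\rangle A$ iff, for some alpha-variant $(\alpha',A')$ of $(\alpha,A)$ with $\operatorname{bn}(\alpha')\# f(P),F,f$, there is $P'$ with $f(P)\xrightarrow{\alpha'}P'$ and $P'\models A'$. Write $P\overset{F/L}{=}Q$ if $P$ and $Q$ satisfy the same formulas of $\mathcal A^{F/L}$. **Theorem.** For all $F\in\mathcal P_{\mathrm{fs}}(\mathcal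 F)$ and all states $P,Q$, $$P\overset{F/L}{\sim}Q\quad\Longleftrightarrow\quad P\overset{F/L}{=}Q .$$ -/

import Mathlib

open scoped Pointwise Cardinal

universe u v w z

namespace NominalTS

/-! ### Names, permutations, support, nominal sets -/

/-- A countably infinite multi-sorted set of names, with infinitely many names of each sort. -/
class Names (𝒩 : Type u) where
  /-- the sorts -/
  Srt : Type u
  /-- the sort of a name -/
  sort : 𝒩 → Srt
  countable : Countable 𝒩
  infinite : Infinite 𝒩
  infinite_sort : ∀ a : 𝒩, {b : 𝒩 | sort b = sort a}.Infinite

/-- The group of sort-preserving bijections on names that move only finitely many names. -/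
def permGroup (𝒩 : Type u) [Names 𝒩] : Subgroup (Equiv.Perm 𝒩) where
  carrier := {π | {a | π a ≠ a}.Finite ∧ ∀ a, Names.sort (π a) = Names.sort a}
  one_mem' := by simp
  mul_mem' := by
    rintro π ρ ⟨h1, h2⟩ ⟨h3, h4⟩
    refine ⟨(h1.union h3).subset ?_, fun a => ?_⟩
    · intro a ha
      by_cases h : ρ a = a
      · left
        simpa [h] using ha
      · exact Or.inr h
    · simp [h2, h4]
  inv_mem' := by
    rintro π ⟨h1, h2⟩
    refine ⟨h1.subset ?_, fun a => ?_⟩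
    · intro a ha h
      exact ha (by rw [Equiv.Perm.inv_eq_iff_eq, h])
    · have := h2 (π⁻¹ a)
      simpa using this.symm

/-- The type of permutations of names. -/
abbrev NPerm (𝒩 : Type u) [Names 𝒩] : Type u := ↥(permGroup 𝒩)

/-- `S` supports `x`: every permutation that leaves all members of `S` invariant fixes `x`. -/
def Supports {𝒩 : Type u} [Names 𝒩] {X : Type v} [MulAction (NPerm 𝒩) X]
    (S : Set 𝒩) (x : X) : Prop :=
  ∀ π : NPerm 𝒩, (∀ a ∈ S, π • a = a) → π • x = x

/-- `x` has a finite supporting set. -/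
def FinSupp (𝒩 : Type u) [Names 𝒩] {X : Type v} [MulAction (NPerm 𝒩) X] (x : X) : Prop :=
  ∃ S : Finset 𝒩, Supports (S : Set 𝒩) x

/-- The least finite supporting set of a finitely supported object, obtained as the intersection
of all finite supporting sets. -/
def supp (𝒩 : Type u) [Names 𝒩] {X : Type v} [MulAction (NPerm 𝒩) X] (x : X) : Set 𝒩 :=
  {a | ∀ S : Finset 𝒩, Supports (S : Set 𝒩) x → a ∈ S}

/-- `N # x`: no name in `N` is in the support of `x`. -/
def Fresh {𝒩 : Type u} [Names 𝒩] {X : Type v} [MulAction (NPerm 𝒩) X]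
    (N : Finset 𝒩) (x : X) : Prop :=
  ∀ a ∈ N, a ∉ supp 𝒩 x

/-- A nominal set: a set with a permutation action, each member of which has finite support. -/
class Nominal (𝒩 : Type u) [Names 𝒩] (X : Type v) extends MulAction (NPerm 𝒩) X where
  finSupp : ∀ x : X, FinSupp 𝒩 x

theorem Supports.smul {𝒩 : Type u} [Names 𝒩] {X : Type v} [MulAction (NPerm 𝒩) X]
    {S : Set 𝒩} {x : X} (h : Supports S x) (π : NPerm 𝒩) : Supports (π • S) (π • x) := by
  intro ρ hρ
  have : (π⁻¹ * ρ * π) • x = x := by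
    apply h
    intro a ha
    have := hρ (π • a) (Set.smul_mem_smul_set ha)
    rw [mul_smul, mul_smul, this, inv_smul_smul]
  calc ρ • π • x = π • (π⁻¹ * ρ * π) • x := by simp [mul_smul]
    _ = π • x := by rw [this]

theorem smul_mem_supp_smul {𝒩 : Type u} [Names 𝒩] [DecidableEq 𝒩] {X : Type v}
    [MulAction (NPerm 𝒩) X] (π : NPerm 𝒩) (a : 𝒩) (x : X) :
    π • a ∈ supp 𝒩 (π • x) ↔ a ∈ supp 𝒩 x := by
  constructor
  · intro h S hS
    have := h (π • S) (by rw [Finset.coe_smul_finset]; exact hS.smul π)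
    exact (Finset.smul_mem_smul_finset_iff π).1 this
  · intro h S hS
    have := h (π⁻¹ • S) (by
      rw [Finset.coe_smul_finset]
      simpa using hS.smul π⁻¹)
    rwa [← Finset.smul_mem_smul_finset_iff π, smul_inv_smul] at this

/-! ### Name abstraction -/

section NameAbs

variable (𝒩 : Type u) [Names 𝒩] [DecidableEq 𝒩] (X : Type v) [MulAction (NPerm 𝒩) X]

/-- Nominal alpha-equivalence of pairs of a finite set of (bound) names and an object. -/
def alphaSetoid : Setoid (Finset 𝒩 × X) where
  r p q := ∃ π : NPerm 𝒩, π • p = q ∧ ∀ a ∈ supp 𝒩 p.2, a ∉ p.1 → π • a = a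
  iseqv := by
    refine ⟨fun p => ⟨1, by simp, by simp⟩, ?_, ?_⟩
    · rintro ⟨N, x⟩ _ ⟨π, rfl, h⟩
      refine ⟨π⁻¹, by simp, fun a ha hN => ?_⟩
      obtain ⟨b, rfl⟩ : ∃ b, π • b = a := ⟨π⁻¹ • a, by simp⟩
      have := h b ((smul_mem_supp_smul π b x).1 ha)
        (fun hb => hN (Finset.smul_mem_smul_finset hb))
      rw [inv_smul_smul, this]
    · rintro ⟨N, x⟩ _ _ ⟨π, rfl, h⟩ ⟨ρ, rfl, h'⟩
      refine ⟨ρ * π, by simp [mul_smul], fun a ha hN => ?_⟩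
      have := h' (π • a) ((smul_mem_supp_smul π a x).2 ha)
        (fun hb => hN ((Finset.smul_mem_smul_finset_iff π).1 hb))
      rw [mul_smul, this, h a ha hN]

/-- The set of alpha-equivalence classes `⟨N⟩x`, where `N` is a finite set of names. -/
def NameAbs : Type (max u v) := Quotient (alphaSetoid 𝒩 X)

variable {𝒩 X}

/-- The class `⟨N⟩x`. -/
def NameAbs.mk (N : Finset 𝒩) (x : X) : NameAbs 𝒩 X := Quotient.mk (alphaSetoid 𝒩 X) (N, x)

/-- Permutations act on classes by `π • ⟨N⟩x = ⟨π • N⟩(π • x)`. -/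
instance : MulAction (NPerm 𝒩) (NameAbs 𝒩 X) where
  smul π := Quotient.map (π • ·) (by
    rintro ⟨N, x⟩ _ ⟨ρ, rfl, h⟩
    refine ⟨π * ρ * π⁻¹, by simp [mul_smul], fun a ha hN => ?_⟩
    obtain ⟨b, rfl⟩ : ∃ b, π • b = a := ⟨π⁻¹ • a, by simp⟩
    have := h b ((smul_mem_supp_smul π b x).1 ha)
      (fun hb => hN (Finset.smul_mem_smul_finset hb))
    simp [mul_smul, this])
  one_smul := by
    rintro ⟨p⟩
    exact congrArg (Quotient.mk _) (one_smul _ p)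
  mul_smul π ρ := by
    rintro ⟨p⟩
    exact congrArg (Quotient.mk _) (mul_smul π ρ p)

end NameAbs

/-! ### Nominal transition systems -/

/-- A nominal transition system with given nominal sets of states, state predicates and actions. -/
structure NTS (𝒩 : Type u) [Names 𝒩] [DecidableEq 𝒩] (State : Type v) (Pred : Type w)
    (Act : Type z) [Nominal 𝒩 State] [Nominal 𝒩 Pred] [Nominal 𝒩 Act] where
  /-- `entails P φ`: the state predicate `φ` holds in the state `P` -/
  entails : State → Pred → Prop
  entails_equivariant : ∀ (π : NPerm 𝒩) P φ, entails (π • P) (π • φ) ↔ entails P φ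
  /-- the binding names of an action -/
  bn : Act → Finset 𝒩
  bn_equivariant : ∀ (π : NPerm 𝒩) α, bn (π • α) = π • bn α
  bn_subset_supp : ∀ α, (bn α : Set 𝒩) ⊆ supp 𝒩 α
  /-- the transition relation, between states and residuals -/
  transitions : Set (State × NameAbs 𝒩 (Act × State))
  transitions_equivariant : ∀ π : NPerm 𝒩, π • transitions = transitions
  bn_eq_of_mem : ∀ P N α Q, (P, NameAbs.mk N (α, Q)) ∈ transitions → bn α = N

/-- The transition `P -α→ P'`. -/
def NTS.Trans {𝒩 : Type u} [Names 𝒩] [DecidableEq 𝒩] {State : Type v} {Pred : Type w}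
    {Act : Type z} [Nominal 𝒩 State] [Nominal 𝒩 Pred] [Nominal 𝒩 Act]
    (T : NTS 𝒩 State Pred Act) (P : State) (α : Act) (P' : State) : Prop :=
  (P, NameAbs.mk (T.bn α) (α, P')) ∈ T.transitions

/-! ### Effects and finitely supported sets of effects -/

/-- A nominal set of effects, i.e. of finitely supported functions from states to states. The
permutation action on functions is `(π • f) P = π • f (π⁻¹ • P)`. -/
structure EffectSet (𝒩 : Type u) [Names 𝒩] (State : Type v) [Nominal 𝒩 State] where
  carrier : Set (State → State)
  smul_mem : ∀ (π : NPerm 𝒩), ∀ f ∈ carrier, (fun P => π • f (π⁻¹ • P)) ∈ carrier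
  finSupp : ∀ f ∈ carrier, ∃ S : Finset 𝒩, ∀ π : NPerm 𝒩, (∀ a ∈ S, π • a = a) →
    ∀ P, π • f P = f (π • P)

/-- The type of the effects in a nominal set of effects. -/
structure EffectSet.Effect {𝒩 : Type u} [Names 𝒩] {State : Type v} [Nominal 𝒩 State]
    (ℱ : EffectSet 𝒩 State) where
  toFun : State → State
  mem : toFun ∈ ℱ.carrier

instance {𝒩 : Type u} [Names 𝒩] {State : Type v} [Nominal 𝒩 State] (ℱ : EffectSet 𝒩 State) :
    CoeFun ℱ.Effect (fun _ => State → State) := ⟨EffectSet.Effect.toFun⟩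

instance {𝒩 : Type u} [Names 𝒩] {State : Type v} [Nominal 𝒩 State] (ℱ : EffectSet 𝒩 State) :
    Nominal 𝒩 ℱ.Effect where
  smul π f := ⟨fun P => π • f (π⁻¹ • P), ℱ.smul_mem π f f.mem⟩
  one_smul f := by
    change EffectSet.Effect.mk _ _ = f
    cases f
    simp
  mul_smul π ρ f := by
    change EffectSet.Effect.mk _ _ = EffectSet.Effect.mk _ _
    simp only [mul_smul, mul_inv_rev]
    rfl
  finSupp f := by
    obtain ⟨S, hS⟩ := ℱ.finSupp f f.mem
    refine ⟨S, fun π hπ => ?_⟩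
    change EffectSet.Effect.mk _ _ = f
    cases f
    simp [hS π hπ]

/-- The nominal set of finitely supported subsets of `X`. -/
def Pfs (𝒩 : Type u) [Names 𝒩] (X : Type v) [MulAction (NPerm 𝒩) X] : Type v :=
  {F : Set X // FinSupp 𝒩 F}

instance {𝒩 : Type u} [Names 𝒩] {X : Type v} [MulAction (NPerm 𝒩) X] :
    Membership X (Pfs 𝒩 X) := ⟨fun F x => x ∈ F.1⟩

instance {𝒩 : Type u} [Names 𝒩] [DecidableEq 𝒩] {X : Type v} [MulAction (NPerm 𝒩) X] :
    Nominal 𝒩 (Pfs 𝒩 X) where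
  smul π F := ⟨π • F.1, by
    obtain ⟨S, hS⟩ := F.2
    exact ⟨π • S, by rw [Finset.coe_smul_finset]; exact hS.smul π⟩⟩
  one_smul F := Subtype.ext (one_smul _ F.1)
  mul_smul π ρ F := Subtype.ext (mul_smul π ρ F.1)
  finSupp F := by
    obtain ⟨S, hS⟩ := F.2
    exact ⟨S, fun π hπ => Subtype.ext (hS π hπ)⟩

/-- The type of the functions `L`. -/
abbrev Later {𝒩 : Type u} [Names 𝒩] {State : Type v} [Nominal 𝒩 State] (Act : Type z)
    (ℱ : EffectSet 𝒩 State) : Type (max v z) :=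
  Act → Pfs 𝒩 ℱ.Effect → ℱ.Effect → Pfs 𝒩 ℱ.Effect

/-- Equivariance of `L`. -/
def Later.Equivariant {𝒩 : Type u} [Names 𝒩] [DecidableEq 𝒩] {State : Type v} [Nominal 𝒩 State]
    {Act : Type z} [Nominal 𝒩 Act] {ℱ : EffectSet 𝒩 State} (L : Later Act ℱ) : Prop :=
  ∀ (π : NPerm 𝒩) α F f, π • L α F f = L (π • α) (π • F) (π • f)

/-! ### `F/L`-bisimilarity -/

section Bisim

variable {𝒩 : Type u} [Names 𝒩] [DecidableEq 𝒩] {State : Type v} {Pred : Type w} {Act : Type z}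
  [Nominal 𝒩 State] [Nominal 𝒩 Pred] [Nominal 𝒩 Act]

/-- `L`-bisimulations: families of symmetric relations with static implication and simulation. -/
structure IsLBisimulation (T : NTS 𝒩 State Pred Act) {ℱ : EffectSet 𝒩 State} (L : Later Act ℱ)
    (R : Pfs 𝒩 ℱ.Effect → State → State → Prop) : Prop where
  symm : ∀ F P Q, R F P Q → R F Q P
  static : ∀ F P Q, R F P Q → ∀ f ∈ F, ∀ φ, T.entails (f P) φ → T.entails (f Q) φ
  simulation : ∀ F P Q, R F P Q → ∀ f ∈ F, ∀ α P',
    Fresh (T.bn α) (f Q) → Fresh (T.bn α) F → Fresh (T.bn α) f →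
    ∃ Q', T.Trans (f P) α P' → T.Trans (f Q) α Q' ∧ R (L α F f) P' Q'

/-- `F/L`-bisimilarity. -/
def FLBisimilar (T : NTS 𝒩 State Pred Act) {ℱ : EffectSet 𝒩 State} (L : Later Act ℱ)
    (F : Pfs 𝒩 ℱ.Effect) (P Q : State) : Prop :=
  ∃ R, IsLBisimulation T L R ∧ R F P Q

end Bisim

/-! ### Formulas -/

/-- Formulas before identification up to alpha-equivalence: conjunctions of fewer than `κ`
formulas, negation, `⟨f⟩φ` and `⟨f⟩⟨α⟩A`, with `f : E`, `φ : Pred`, `α : Act`. Conjunctions are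
indexed by subsets of a set of cardinality `κ`. -/
inductive RawFormula (κ : Cardinal.{u}) (E : Type v) (Pred : Type w) (Act : Type z) :
    Type (max u v w z)
  | conj (I : Set κ.out) (hI : #I < κ) (A : I → RawFormula κ E Pred Act) :
      RawFormula κ E Pred Act
  | neg (A : RawFormula κ E Pred Act) : RawFormula κ E Pred Act
  | pred (f : E) (φ : Pred) : RawFormula κ E Pred Act
  | act (f : E) (α : Act) (A : RawFormula κ E Pred Act) : RawFormula κ E Pred Act

section Formula

variable {𝒩 : Type u} [Names 𝒩] [DecidableEq 𝒩] {State : Type v} {Pred : Type w} {Act : Type z}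
  [Nominal 𝒩 State] [Nominal 𝒩 Pred] [Nominal 𝒩 Act]

/-- Permutations distribute over all constructors. -/
def RawFormula.perm {κ : Cardinal.{v}} {E : Type v} [MulAction (NPerm 𝒩) E] (π : NPerm 𝒩) :
    RawFormula κ E Pred Act → RawFormula κ E Pred Act
  | conj I hI A => conj I hI (fun i => (A i).perm π)
  | neg A => neg (A.perm π)
  | pred f φ => pred (π • f) (π • φ)
  | act f α A => act (π • f) (π • α) (A.perm π)

instance {κ : Cardinal.{v}} {E : Type v} [MulAction (NPerm 𝒩) E] :
    MulAction (NPerm 𝒩) (RawFormula κ E Pred Act) where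
  smul π A := A.perm π
  one_smul A := by
    change A.perm 1 = A
    induction A <;> simp_all [RawFormula.perm]
  mul_smul π ρ A := by
    change A.perm (π * ρ) = (A.perm ρ).perm π
    induction A <;> simp_all [RawFormula.perm, mul_smul]

variable (T : NTS 𝒩 State Pred Act) (ℱ : EffectSet 𝒩 State) (κ : Cardinal.{v})

/-- Alpha-equivalence of formulas: the least equivalence relation that is compatible with the
constructors, identifies conjunctions with the same set of conjuncts, and identifies the pairs
`(α, A)` and `π • (α, A)` under an action modality whenever `π` fixes all names that are in the
(finite) support of `α` or of the class of `A` but not in `bn α`. -/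
inductive AlphaEq :
    RawFormula κ ℱ.Effect Pred Act → RawFormula κ ℱ.Effect Pred Act → Prop
  | refl (A) : AlphaEq A A
  | symm {A B} : AlphaEq A B → AlphaEq B A
  | trans {A B C} : AlphaEq A B → AlphaEq B C → AlphaEq A C
  | conj {I J : Set κ.out} {hI hJ A B} (g : I → J) (h : J → I) :
      (∀ i, AlphaEq (A i) (B (g i))) → (∀ j, AlphaEq (A (h j)) (B j)) →
      AlphaEq (.conj I hI A) (.conj J hJ B)
  | neg {A B} : AlphaEq A B → AlphaEq (.neg A) (.neg B)
  | act {f α A B} : AlphaEq A B → AlphaEq (.act f α A) (.act f α B)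
  | alpha {f α A} (N : Finset 𝒩) (π : NPerm 𝒩) :
      Supports (N : Set 𝒩) α →
      (∀ ρ : NPerm 𝒩, (∀ a ∈ N, ρ • a = a) → AlphaEq (ρ • A) A) →
      (∀ a ∈ N, a ∉ T.bn α → π • a = a) →
      AlphaEq (.act f α A) (.act f (π • α) (π • A))

theorem AlphaEq.smul {A B : RawFormula κ ℱ.Effect Pred Act} (h : AlphaEq T ℱ κ A B)
    (τ : NPerm 𝒩) : AlphaEq T ℱ κ (τ • A) (τ • B) := by
  induction h generalizing τ with
  | refl A => exact .refl _
  | symm _ ih => exact .symm (ih τ)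
  | trans _ _ ih ih' => exact .trans (ih τ) (ih' τ)
  | conj g h _ _ ih ih' => exact .conj g h (fun i => ih i τ) (fun j => ih' j τ)
  | neg _ ih => exact .neg (ih τ)
  | act _ ih => exact .act (ih τ)
  | @alpha f α A N π hα hA hπ ih =>
    have key : AlphaEq T ℱ κ (.act (τ • f) (τ • α) (τ • A))
        (.act (τ • f) ((τ * π * τ⁻¹) • τ • α) ((τ * π * τ⁻¹) • τ • A)) := by
      refine .alpha (τ • N) _ ?_ ?_ ?_
      · rw [Finset.coe_smul_finset]
        exact hα.smul τ
      · intro ρ hρ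
        have := ih (τ⁻¹ * ρ * τ) (fun a ha => by
          have := hρ (τ • a) (Finset.smul_mem_smul_finset ha)
          rw [mul_smul, mul_smul, this, inv_smul_smul]) τ
        simpa [smul_smul, mul_assoc] using this
      · intro a ha hb
        obtain ⟨b, rfl⟩ : ∃ b, τ • b = a := ⟨τ⁻¹ • a, by simp⟩
        rw [T.bn_equivariant] at hb
        have := hπ b ((Finset.smul_mem_smul_finset_iff τ).1 ha)
          (fun h => hb (Finset.smul_mem_smul_finset h))
        simp [mul_smul, this]
    change AlphaEq T ℱ κ (.act (τ • f) (τ • α) (τ • A))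
      (.act (τ • f) (τ • π • α) (τ • π • A))
    simpa [smul_smul, mul_assoc] using key

/-- Alpha-equivalence as a setoid. -/
def formulaSetoid : Setoid (RawFormula κ ℱ.Effect Pred Act) where
  r := AlphaEq T ℱ κ
  iseqv := ⟨.refl, .symm, .trans⟩

/-- Formulas up to alpha-equivalence. Those that occur in the logic are singled out by
`IsFLFormula`. -/
def Formula : Type (max v w z) := Quotient (formulaSetoid T ℱ κ)

variable {T ℱ κ}

/-- The formula represented by a raw formula. -/
def RawFormula.toFormula (T : NTS 𝒩 State Pred Act) (A : RawFormula κ ℱ.Effect Pred Act) :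
    Formula T ℱ κ :=
  Quotient.mk (formulaSetoid T ℱ κ) A

instance : MulAction (NPerm 𝒩) (Formula T ℱ κ) where
  smul π := Quotient.map (π • ·) (fun _ _ h => AlphaEq.smul T ℱ κ h π)
  one_smul := by
    rintro ⟨A⟩
    exact congrArg (Quotient.mk _) (one_smul _ A)
  mul_smul π ρ := by
    rintro ⟨A⟩
    exact congrArg (Quotient.mk _) (mul_smul π ρ A)

theorem smul_toFormula (π : NPerm 𝒩) (A : RawFormula κ ℱ.Effect Pred Act) :
    π • A.toFormula T = (π • A).toFormula T := rfl

/-- `IsFLFormula L F A`: the formula `A` belongs to the set `𝒜^{F/L}`. -/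
inductive IsFLFormula (L : Later Act ℱ) : Pfs 𝒩 ℱ.Effect → Formula T ℱ κ → Prop
  | conj {F} (I : Set κ.out) (hI : #I < κ) (A : I → RawFormula κ ℱ.Effect Pred Act) :
      (∀ i, IsFLFormula L F ((A i).toFormula T)) →
      FinSupp 𝒩 (Set.range fun i => (A i).toFormula T) →
      IsFLFormula L F ((RawFormula.conj I hI A).toFormula T)
  | neg {F} (A : RawFormula κ ℱ.Effect Pred Act) :
      IsFLFormula L F (A.toFormula T) → IsFLFormula L F ((RawFormula.neg A).toFormula T)
  | pred {F} (f : ℱ.Effect) (φ : Pred) :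
      f ∈ F → IsFLFormula L F ((RawFormula.pred f φ).toFormula T)
  | act {F} (f : ℱ.Effect) (α : Act) (A : RawFormula κ ℱ.Effect Pred Act) :
      f ∈ F → Fresh (T.bn α) f → Fresh (T.bn α) F →
      IsFLFormula L (L α F f) (A.toFormula T) →
      IsFLFormula L F ((RawFormula.act f α A).toFormula T)

/-- `A.Sat T L π F P`: the state `P` satisfies the formula `π • A`, by recursion on `A`. In the
clause for `⟨f⟩⟨α⟩A`, the alpha-variants of `⟨bn α⟩(α, A)` are `σ • (α, A)` with `σ` fixing all
names in `supp (α, A)` outside `bn α`; a variant whose binding names are fresh for the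
state, `F` and `f` is used. The clauses on formulas are `valid_conj`, `valid_neg`, `valid_pred`
and `valid_act` below. -/
def RawFormula.Sat (T : NTS 𝒩 State Pred Act) (L : Later Act ℱ) :
    RawFormula κ ℱ.Effect Pred Act → NPerm 𝒩 → Pfs 𝒩 ℱ.Effect → State → Prop
  | conj _ _ A, π, F, P => ∀ i, (A i).Sat T L π F P
  | neg A, π, F, P => ¬ A.Sat T L π F P
  | pred f φ, π, _, P => T.entails ((π • f : ℱ.Effect) P) (π • φ)
  | act f α A, π, F, P => ∃ σ : NPerm 𝒩,
      (∀ a ∈ supp 𝒩 (π • α, π • A.toFormula T), a ∉ T.bn (π • α) → σ • a = a) ∧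
      Fresh (T.bn (σ • π • α)) ((π • f : ℱ.Effect) P) ∧
      Fresh (T.bn (σ • π • α)) F ∧ Fresh (T.bn (σ • π • α)) (π • f) ∧
      ∃ P', T.Trans ((π • f : ℱ.Effect) P) (σ • π • α) P' ∧
        A.Sat T L (σ * π) (L (σ • π • α) F (π • f)) P'

theorem RawFormula.sat_smul (L : Later Act ℱ) (τ : NPerm 𝒩)
    (A : RawFormula κ ℱ.Effect Pred Act) (π : NPerm 𝒩) (F : Pfs 𝒩 ℱ.Effect) (P : State) :
    (τ • A).Sat T L π F P ↔ A.Sat T L (π * τ) F P := by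
  induction A generalizing π F P with
  | conj I hI A ih => exact forall_congr' fun i => ih i π F P
  | neg A ih => exact not_congr (ih π F P)
  | pred f φ =>
    change T.entails ((π • τ • f : ℱ.Effect) P) (π • τ • φ) ↔
      T.entails (((π * τ) • f : ℱ.Effect) P) ((π * τ) • φ)
    rw [mul_smul, mul_smul]
  | act f α A ih =>
    change (RawFormula.act (τ • f) (τ • α) (τ • A)).Sat T L π F P ↔ _
    simp only [RawFormula.Sat, ih, ← smul_toFormula, mul_smul, mul_assoc]

theorem RawFormula.sat_alphaEq (L : Later Act ℱ) {A B : RawFormula κ ℱ.Effect Pred Act}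
    (h : AlphaEq T ℱ κ A B) (π : NPerm 𝒩) (F : Pfs 𝒩 ℱ.Effect) (P : State) :
    A.Sat T L π F P ↔ B.Sat T L π F P := by
  induction h generalizing π F P with
  | refl A => rfl
  | symm _ ih => exact (ih π F P).symm
  | trans _ _ ih ih' => exact (ih π F P).trans (ih' π F P)
  | conj g h _ _ ih ih' =>
    exact ⟨fun H j => (ih' j π F P).1 (H (h j)), fun H i => (ih i π F P).2 (H (g i))⟩
  | neg _ ih => exact not_congr (ih π F P)
  | @act f α A B h ih =>
    have : A.toFormula T = B.toFormula T := Quotient.sound h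
    simp only [RawFormula.Sat, ih, this]
  | @alpha f α A N τ hα hA hτ ih =>
    have hsub : ∀ a ∈ supp 𝒩 (α, A.toFormula T), a ∉ T.bn α → τ • a = a := by
      intro a ha
      refine hτ a (ha N fun ρ hρ => Prod.ext (hα ρ hρ) ?_)
      exact Quotient.sound (hA ρ hρ)
    have hfix : ∀ σ : NPerm 𝒩,
        (∀ a ∈ supp 𝒩 (π • α, π • A.toFormula T), a ∉ T.bn (π • α) → σ • a = a) ↔
        ∀ b ∈ supp 𝒩 (α, A.toFormula T), b ∉ T.bn α → σ • π • b = π • b := by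
      intro σ
      constructor
      · intro H b hb hb'
        refine H (π • b) ((smul_mem_supp_smul π b (α, A.toFormula T)).2 hb) ?_
        rwa [T.bn_equivariant, Finset.smul_mem_smul_finset_iff]
      · intro H a ha ha'
        obtain ⟨b, rfl⟩ : ∃ b, π • b = a := ⟨π⁻¹ • a, by simp⟩
        rw [T.bn_equivariant, Finset.smul_mem_smul_finset_iff] at ha'
        exact H b ((smul_mem_supp_smul π b (α, A.toFormula T)).1 ha) ha'
    have hfix' : ∀ σ : NPerm 𝒩,
        (∀ a ∈ supp 𝒩 (π • τ • α, π • (τ • A).toFormula T), a ∉ T.bn (π • τ • α) →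
          σ • a = a) ↔
        ∀ b ∈ supp 𝒩 (α, A.toFormula T), b ∉ T.bn α → σ • π • b = π • b := by
      intro σ
      rw [← smul_toFormula]
      constructor
      · intro H b hb hb'
        have := H (π • τ • b) ((smul_mem_supp_smul π _ (τ • (α, A.toFormula T))).2
          ((smul_mem_supp_smul τ b (α, A.toFormula T)).2 hb)) (by
            rwa [T.bn_equivariant, T.bn_equivariant, Finset.smul_mem_smul_finset_iff,
              Finset.smul_mem_smul_finset_iff])
        rwa [hsub b hb hb'] at this
      · intro H a ha ha'
        obtain ⟨b, rfl⟩ : ∃ b, π • τ • b = a := ⟨τ⁻¹ • π⁻¹ • a, by simp⟩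
        rw [T.bn_equivariant, T.bn_equivariant, Finset.smul_mem_smul_finset_iff,
          Finset.smul_mem_smul_finset_iff] at ha'
        have hb := (smul_mem_supp_smul τ b (α, A.toFormula T)).1
          ((smul_mem_supp_smul π _ (τ • (α, A.toFormula T))).1 ha)
        rw [hsub b hb ha']
        exact H b hb ha'
    simp only [RawFormula.Sat, RawFormula.sat_smul, hfix, hfix']
    constructor
    · rintro ⟨σ, h1, h2⟩
      refine ⟨σ * π * τ⁻¹ * π⁻¹, fun b hb hb' => ?_, ?_⟩
      · have : τ⁻¹ • b = b := by rw [inv_smul_eq_iff, hsub b hb hb']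
        simp [mul_smul, this, h1 b hb hb']
      · have e : σ * π * τ⁻¹ * π⁻¹ * π * τ = σ * π := by group
        rw [e]
        simpa [mul_smul] using h2
    · rintro ⟨σ, h1, h2⟩
      refine ⟨σ * π * τ * π⁻¹, fun b hb hb' => ?_, ?_⟩
      · simp [mul_smul, hsub b hb hb', h1 b hb hb']
      · have e : σ * π * τ * π⁻¹ * π = σ * π * τ := by group
        rw [e]
        simpa [mul_smul] using h2

/-- `Valid L F P A`: validity of the formula `A` for the state `P`. The index `F` only matters
for the choice of representatives of `⟨α⟩A` whose binding names are fresh. -/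
def Valid (L : Later Act ℱ) (F : Pfs 𝒩 ℱ.Effect) (P : State) (A : Formula T ℱ κ) : Prop :=
  Quotient.lift (fun B : RawFormula κ ℱ.Effect Pred Act => B.Sat T L 1 F P)
    (fun _ _ h => propext (RawFormula.sat_alphaEq L h 1 F P)) A

theorem valid_conj (L : Later Act ℱ) (F : Pfs 𝒩 ℱ.Effect) (P : State) (I : Set κ.out)
    (hI : #I < κ) (A : I → RawFormula κ ℱ.Effect Pred Act) :
    Valid L F P ((RawFormula.conj I hI A).toFormula T) ↔
      ∀ i, Valid L F P ((A i).toFormula T) := Iff.rfl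

theorem valid_neg (L : Later Act ℱ) (F : Pfs 𝒩 ℱ.Effect) (P : State)
    (A : RawFormula κ ℱ.Effect Pred Act) :
    Valid L F P ((RawFormula.neg A).toFormula T) ↔ ¬ Valid L F P (A.toFormula T) := Iff.rfl

theorem valid_pred (L : Later Act ℱ) (F : Pfs 𝒩 ℱ.Effect) (P : State) (f : ℱ.Effect)
    (φ : Pred) :
    Valid L F P ((RawFormula.pred (κ := κ) (Act := Act) f φ).toFormula T) ↔
      T.entails (f P) φ := by
  change T.entails (((1 : NPerm 𝒩) • f : ℱ.Effect) P) ((1 : NPerm 𝒩) • φ) ↔ _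
  rw [one_smul, one_smul]

theorem valid_act (L : Later Act ℱ) (F : Pfs 𝒩 ℱ.Effect) (P : State) (f : ℱ.Effect) (α : Act)
    (A : RawFormula κ ℱ.Effect Pred Act) :
    Valid L F P ((RawFormula.act f α A).toFormula T) ↔
      ∃ (α' : Act) (A' : RawFormula κ ℱ.Effect Pred Act),
        NameAbs.mk (T.bn α) (α, A.toFormula T) = NameAbs.mk (T.bn α') (α', A'.toFormula T) ∧
        Fresh (T.bn α') (f P) ∧ Fresh (T.bn α') F ∧ Fresh (T.bn α') f ∧
        ∃ P', T.Trans (f P) α' P' ∧ Valid L (L α' F f) P' (A'.toFormula T) := by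
  change (RawFormula.act f α A).Sat T L 1 F P ↔ _
  simp only [RawFormula.Sat, one_smul, mul_one]
  have hsat : ∀ σ G P', A.Sat T L σ G P' ↔ Valid L G P' ((σ • A).toFormula T) := by
    intro σ G P'
    change _ ↔ (σ • A).Sat T L 1 G P'
    rw [RawFormula.sat_smul, one_mul]
  constructor
  · rintro ⟨σ, h1, h2, h3, h4, P', h5, h6⟩
    refine ⟨σ • α, σ • A, ?_, h2, h3, h4, P', h5, (hsat _ _ _).1 h6⟩
    exact Quotient.sound ⟨σ, Prod.ext (T.bn_equivariant σ α).symm rfl, h1⟩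
  · rintro ⟨α', A', e, h2, h3, h4, P', h5, h6⟩
    obtain ⟨σ, hσ, h1⟩ := Quotient.exact e
    have e1 : σ • α = α' := congrArg (fun p => p.2.1) hσ
    have e2 : (σ • A).toFormula T = A'.toFormula T := congrArg (fun p => p.2.2) hσ
    subst e1
    exact ⟨σ, h1, h2, h3, h4, P', h5, (hsat _ _ _).2 (e2 ▸ h6)⟩

/-- The states `P` and `Q` satisfy the same formulas in `𝒜^{F/L}`. -/
def FLLogEquiv (T : NTS 𝒩 State Pred Act) (L : Later Act ℱ) (κ : Cardinal.{v})
    (F : Pfs 𝒩 ℱ.Effect) (P Q : State) : Prop :=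
  ∀ A : Formula T ℱ κ, IsFLFormula L F A → (Valid L F P A ↔ Valid L F Q A)

end Formula

end NominalTS

/-! Bisimilar states satisfy the same formulas by induction on the formula
(`IsFLFormula.valid_of_bisimilar`). For `⟨f⟩⟨α⟩A` true at `P`, `exists_smul_of_valid_act` supplies a
witness whose binding names are also fresh for `f Q`, so that the simulation clause applies. The
renaming `ρ` used there fixes `F` and `f`, hence `L (ρ • α) F f = ρ • L α F f`, and equivariance of
validity and of bisimilarity lets `ρ` be undone before the induction hypothesis is used.

Conversely, logical equivalence is itself an `L`-bisimulation (`isLBisimulation_logEquiv`). If `f P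
-α→ P'` had no match, each `α`-successor `Q'` of `f Q` would be separated from `P'` by a formula,
and `⟨f⟩⟨α⟩` applied to the conjunction `C` of these formulas would hold at `P` and fail at `Q`. The
difficulty is that the conjuncts must form a finitely supported set. Hence each of them is replaced
by the conjunction of its orbit under the permutations that fix the support of `P'` and of the index
pointwise (`exists_distinguishing_supports`). The group of permutations is countable, so `ℵ₀ < κ`
admits these conjunctions, while `#State < κ` admits `C`. All conjuncts of `C` then share one finite
support. -/

namespace NominalTS

/-! ### Permutations -/

section Perm

variable {𝒩 : Type u} [Names 𝒩]

/-- The transposition of two names of the same sort. -/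
def NPerm.swap [DecidableEq 𝒩] (a b : 𝒩) (h : Names.sort a = Names.sort b) : NPerm 𝒩 :=
  ⟨Equiv.swap a b, by
    refine ⟨(Set.toFinite {a, b}).subset fun c hc => ?_, fun c => ?_⟩
    · by_contra hn
      simp only [Set.mem_insert_iff, Set.mem_singleton_iff, not_or] at hn
      exact hc (Equiv.swap_apply_of_ne_of_ne hn.1 hn.2)
    · rw [Equiv.swap_apply_def]
      split_ifs with h1 h2
      · rw [h1, h]
      · rw [h2, h]
      · rfl⟩

theorem NPerm.swap_smul_left [DecidableEq 𝒩] (a b : 𝒩) (h : Names.sort a = Names.sort b) :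
    NPerm.swap a b h • a = b := Equiv.swap_apply_left a b

theorem NPerm.swap_smul_of_ne [DecidableEq 𝒩] {a b c : 𝒩} (h : Names.sort a = Names.sort b) (ha : c ≠ a)
    (hb : c ≠ b) : NPerm.swap a b h • c = c := Equiv.swap_apply_of_ne_of_ne ha hb

theorem NPerm.sort_smul (π : NPerm 𝒩) (a : 𝒩) : Names.sort (π • a) = Names.sort a := π.2.2 a

theorem NPerm.finite_moved (π : NPerm 𝒩) : {a : 𝒩 | π • a ≠ a}.Finite := π.2.1

/-- Finitely many names can be renamed to avoid a finite set, leaving the other names of that set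
fixed. -/
theorem exists_perm_avoiding [DecidableEq 𝒩] (B : Finset 𝒩) {C : Set 𝒩} (hC : C.Finite) :
    ∃ π : NPerm 𝒩, (∀ b ∈ B, π • b ∉ C) ∧ ∀ a ∈ C, a ∉ B → π • a = a := by
  induction B using Finset.induction_on generalizing C with
  | empty => exact ⟨1, by simp, by simp⟩
  | insert b B hb ih =>
    -- Adding `b` to the avoided set makes `π` fix `b` and keeps the images of `B` away from it.
    -- Then `b` can be swapped with a fresh name of its sort without disturbing `π` on `B`.
    obtain ⟨π, h1, h2⟩ := ih (C := insert b C) (hC.insert b)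
    have hπb : π • b = b := h2 b (Set.mem_insert _ _) hb
    obtain ⟨c, hc, hc'⟩ := (Names.infinite_sort b).exists_notMem_finite
      ((hC.insert b).union (B.finite_toSet.image (π • ·)))
    simp only [Set.mem_union, Set.mem_insert_iff, not_or] at hc'
    refine ⟨NPerm.swap b c (Eq.symm hc) * π, fun x hx => ?_, fun a ha haB => ?_⟩
    · rw [mul_smul]
      rcases Finset.mem_insert.1 hx with rfl | hx
      · rw [hπb, NPerm.swap_smul_left]
        exact hc'.1.2
      · have hx' := h1 x hx
        rw [Set.mem_insert_iff, not_or] at hx'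
        rw [NPerm.swap_smul_of_ne _ hx'.1]
        · exact hx'.2
        · rintro rfl
          exact hc'.2 ⟨x, hx, rfl⟩
    · rw [Finset.mem_insert, not_or] at haB
      rw [mul_smul, h2 a (Set.mem_insert_of_mem _ ha) haB.2, NPerm.swap_smul_of_ne _ haB.1]
      rintro rfl
      exact hc'.1.2 ha

/-- A permutation agrees on a finite set `S` with one that moves only names in `S ∪ π • S`. -/
theorem exists_perm_eqOn [DecidableEq 𝒩] (π : NPerm 𝒩) (S : Finset 𝒩) :
    ∃ ρ : NPerm 𝒩, (∀ a ∈ S, ρ • a = π • a) ∧ ∀ a, a ∉ S → a ∉ π • S → ρ • a = a := by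
  induction S using Finset.induction_on with
  | empty => exact ⟨1, by simp, by simp⟩
  | insert s S hs ih =>
    obtain ⟨ρ, h1, h2⟩ := ih
    have e : Names.sort (ρ • s) = Names.sort (π • s) := by
      rw [NPerm.sort_smul, NPerm.sort_smul]
    -- `ρ` agrees with `π` on `S`, so by injectivity neither swapped name is the image of an element
    -- of `S`: the swap corrects the value at `s` alone.
    refine ⟨NPerm.swap (ρ • s) (π • s) e * ρ, fun a ha => ?_, fun a ha ha' => ?_⟩
    · rw [mul_smul]
      rcases Finset.mem_insert.1 ha with rfl | ha
      · exact NPerm.swap_smul_left _ _ _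
      · have hne : a ≠ s := fun e => hs (e ▸ ha)
        rw [NPerm.swap_smul_of_ne _ ((MulAction.injective ρ).ne hne), h1 a ha]
        rw [h1 a ha]
        exact (MulAction.injective π).ne hne
    · rw [Finset.mem_insert, not_or] at ha
      rw [Finset.smul_finset_insert, Finset.mem_insert, not_or] at ha'
      have := h2 a ha.2 ha'.2
      rw [mul_smul, this, NPerm.swap_smul_of_ne _ _ ha'.1]
      intro h
      exact ha.1 (smul_left_cancel ρ (this.trans h))

theorem NPerm.ext_smul {π ρ : NPerm 𝒩} (h : ∀ a : 𝒩, π • a = ρ • a) : π = ρ :=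
  Subtype.ext (Equiv.ext h)

/-- A permutation is determined by its graph over the names it moves, a finite subset of the
countable set `𝒩 × 𝒩`. This is what bounds orbits of formulas by `ℵ₀`. -/
instance : Countable (NPerm 𝒩) := by
  have : Countable 𝒩 := Names.countable
  have hc : {s : Set (𝒩 × 𝒩) | s.Finite}.Countable := Set.Countable.ofPred_finite
  have := hc.to_subtype
  let g : NPerm 𝒩 → {s : Set (𝒩 × 𝒩) | s.Finite} := fun π =>
    ⟨(fun a => (a, π • a)) '' {a | π • a ≠ a}, π.finite_moved.image _⟩
  refine Function.Injective.countable (f := g) fun π ρ h => NPerm.ext_smul ?_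
  have h' : (fun a => (a, π • a)) '' {a | π • a ≠ a} =
    (fun a => (a, ρ • a)) '' {a | ρ • a ≠ a} := congrArg Subtype.val h
  intro a
  by_cases hπ : π • a = a
  · by_contra hne
    have : (a, ρ • a) ∈ (fun a => (a, π • a)) '' {a | π • a ≠ a} := by
      rw [h']
      exact ⟨a, fun e => hne (hπ.trans e.symm), rfl⟩
    obtain ⟨b, hb, e⟩ := this
    obtain ⟨rfl, -⟩ := Prod.mk.inj e
    exact hb hπ
  · have : (a, π • a) ∈ (fun a => (a, ρ • a)) '' {a | ρ • a ≠ a} := by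
      rw [← h']
      exact ⟨a, hπ, rfl⟩
    obtain ⟨b, -, e⟩ := this
    obtain ⟨rfl, e⟩ := Prod.mk.inj e
    exact e.symm

end Perm

/-! ### Support -/

section Supp

variable {𝒩 : Type u} [Names 𝒩] {X : Type v} [MulAction (NPerm 𝒩) X] {Y : Type w}
  [MulAction (NPerm 𝒩) Y]

/-- Let `π` fix `S ∩ S'` pointwise. Some `ρ` fixes `S'` pointwise, hence `x`, and sends `S \ S'` to
names that `π` does not move. Then `ρ • S` supports `ρ • x = x` and is fixed pointwise by `π`. -/
theorem Supports.inter [DecidableEq 𝒩] {S S' : Finset 𝒩} {x : X} (h : Supports (S : Set 𝒩) x)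
    (h' : Supports (S' : Set 𝒩) x) : Supports ((S ∩ S' : Finset 𝒩) : Set 𝒩) x := by
  intro π hπ
  obtain ⟨ρ, h1, h2⟩ := exists_perm_avoiding (S \ S') (S'.finite_toSet.union π.finite_moved)
  have hρ : ρ • x = x := h' ρ fun a ha => h2 a (Or.inl ha) fun hb =>
    (Finset.mem_sdiff.1 hb).2 ha
  have key := h.smul ρ
  rw [hρ] at key
  refine key π ?_
  rintro _ ⟨a, ha, rfl⟩
  by_cases ha' : a ∈ S'
  · have : ρ • a = a := h2 a (Or.inl ha') fun hb => (Finset.mem_sdiff.1 hb).2 ha'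
    change π • ρ • a = ρ • a
    rw [this]
    exact hπ a (Finset.mem_coe.2 (Finset.mem_inter.2 ⟨ha, ha'⟩))
  · by_contra hn
    exact h1 a (Finset.mem_sdiff.2 ⟨ha, ha'⟩) (Or.inr hn)

/-- By closure under intersection, a finite support of minimal cardinality lies in every other one.
Finite support has to be assumed: otherwise the intersection defining `supp` is over the empty
family and gives all names. -/
theorem FinSupp.exists_finset_eq_supp {x : X} (h : FinSupp 𝒩 x) :
    ∃ S : Finset 𝒩, (S : Set 𝒩) = supp 𝒩 x ∧ Supports (S : Set 𝒩) x := by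
  classical
  obtain ⟨S, hS, hmin⟩ := WellFounded.has_min (measure Finset.card).wf
    {S : Finset 𝒩 | Supports (S : Set 𝒩) x} h
  refine ⟨S, Set.Subset.antisymm (fun a ha S' hS' => ?_) (fun a ha => ha S hS), hS⟩
  have := hmin (S ∩ S') (hS.inter hS')
  have e : S ∩ S' = S := Finset.eq_of_subset_of_card_le Finset.inter_subset_left
    (not_lt.1 this)
  exact (Finset.mem_inter.1 (e.symm ▸ ha : a ∈ S ∩ S')).2

theorem FinSupp.finite_supp {x : X} (h : FinSupp 𝒩 x) : (supp 𝒩 x).Finite := by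
  obtain ⟨S, e, -⟩ := h.exists_finset_eq_supp
  exact e ▸ S.finite_toSet

theorem FinSupp.supports_supp {x : X} (h : FinSupp 𝒩 x) : Supports (supp 𝒩 x) x := by
  obtain ⟨S, e, hS⟩ := h.exists_finset_eq_supp
  exact e ▸ hS

theorem FinSupp.smul {x : X} (h : FinSupp 𝒩 x) (π : NPerm 𝒩) : FinSupp 𝒩 (π • x) := by
  classical
  obtain ⟨S, hS⟩ := h
  exact ⟨π • S, by rw [Finset.coe_smul_finset]; exact hS.smul π⟩

theorem FinSupp.smul_eq_smul {x : X} (h : FinSupp 𝒩 x) {π ρ : NPerm 𝒩}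
    (hπ : ∀ a ∈ supp 𝒩 x, π • a = ρ • a) : π • x = ρ • x := by
  have := h.supports_supp (ρ⁻¹ * π) fun a ha => by rw [mul_smul, hπ a ha, inv_smul_smul]
  rwa [mul_smul, inv_smul_eq_iff] at this

theorem supp_subset_supp_prod_left (x : X) (y : Y) : supp 𝒩 x ⊆ supp 𝒩 (x, y) :=
  fun _ ha S hS => ha S fun π hπ => congrArg Prod.fst (hS π hπ)

theorem supp_subset_supp_prod_right (x : X) (y : Y) : supp 𝒩 y ⊆ supp 𝒩 (x, y) :=
  fun _ ha S hS => ha S fun π hπ => congrArg Prod.snd (hS π hπ)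

theorem FinSupp.prod {x : X} {y : Y} (hx : FinSupp 𝒩 x) (hy : FinSupp 𝒩 y) :
    FinSupp 𝒩 (x, y) := by
  classical
  obtain ⟨S, hS⟩ := hx
  obtain ⟨S', hS'⟩ := hy
  refine ⟨S ∪ S', fun π hπ => Prod.ext (hS π fun a ha => hπ a ?_) (hS' π fun a ha => hπ a ?_)⟩
  · exact Finset.mem_coe.2 (Finset.mem_union_left _ ha)
  · exact Finset.mem_coe.2 (Finset.mem_union_right _ ha)

theorem fresh_smul_iff [DecidableEq 𝒩] (π : NPerm 𝒩) (N : Finset 𝒩) (x : X) :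
    Fresh (π • N) (π • x) ↔ Fresh N x := by
  constructor
  · intro h a ha ha'
    exact h (π • a) (Finset.smul_mem_smul_finset ha) ((smul_mem_supp_smul π a x).2 ha')
  · intro h a ha ha'
    obtain ⟨b, rfl⟩ : ∃ b, π • b = a := ⟨π⁻¹ • a, by simp⟩
    exact h b ((Finset.smul_mem_smul_finset_iff π).1 ha) ((smul_mem_supp_smul π b x).1 ha')

end Supp

theorem finite_supp {𝒩 : Type u} [Names 𝒩] {X : Type v} [Nominal 𝒩 X] (x : X) : (supp 𝒩 x).Finite :=
  FinSupp.finite_supp (Nominal.finSupp x)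

theorem smul_eq_of_forall_supp {𝒩 : Type u} [Names 𝒩] {X : Type v} [Nominal 𝒩 X] {x : X} {π : NPerm 𝒩}
    (h : ∀ a ∈ supp 𝒩 x, π • a = a) : π • x = x :=
  FinSupp.supports_supp (Nominal.finSupp x) π h


theorem FinSupp.range_smul {𝒩 : Type u} [Names 𝒩] {X : Type*}
    [MulAction (NPerm 𝒩) X] {ι : Type*} {g : ι → X}
    (h : FinSupp 𝒩 (Set.range g)) (ρ : NPerm 𝒩) :
    FinSupp 𝒩 (Set.range fun i => ρ • g i) := by
  have : (Set.range fun i => ρ • g i) = ρ • Set.range g := by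
    rw [← Set.image_smul, ← Set.range_comp]
    rfl
  rw [this]
  exact h.smul ρ

/-- Meant for `N = bn α` and `N' = bn (ρ • α)`: a renaming that moves only old and new binding names
fixes whatever both are fresh for. -/
theorem smul_eq_of_fresh {𝒩 : Type u} [Names 𝒩] {X : Type*} [Nominal 𝒩 X] {x : X} {N N' : Finset 𝒩}
    {ρ : NPerm 𝒩}
    (hρ : ∀ a, a ∉ N → a ∉ N' → ρ • a = a) (h : Fresh N x) (h' : Fresh N' x) : ρ • x = x :=
  smul_eq_of_forall_supp fun a ha => hρ a (fun hN => h a hN ha) fun hN => h' a hN ha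

theorem EffectSet.Effect.smul_apply_smul {𝒩 : Type u} [Names 𝒩] {State : Type v}
    [Nominal 𝒩 State] {ℱ : EffectSet 𝒩 State} (π : NPerm 𝒩) (f : ℱ.Effect) (P : State) :
    (π • f : ℱ.Effect) (π • P) = π • f P := by
  change π • f (π⁻¹ • π • P) = _
  rw [inv_smul_smul]

/-! ### Equivariance -/

section Equivariance

variable {𝒩 : Type u} [Names 𝒩] [DecidableEq 𝒩] {State : Type v} {Pred : Type w} {Act : Type z}
  [Nominal 𝒩 State] [Nominal 𝒩 Pred] [Nominal 𝒩 Act]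
  {T : NTS 𝒩 State Pred Act} {ℱ : EffectSet 𝒩 State} {κ : Cardinal.{v}}
  {L : Later Act ℱ}

theorem Pfs.smul_mem_smul (π : NPerm 𝒩) {f : ℱ.Effect} {F : Pfs 𝒩 ℱ.Effect} (h : f ∈ F) :
    π • f ∈ π • F := Set.smul_mem_smul_set (a := π) (s := F.1) h

theorem NTS.Trans.smul (π : NPerm 𝒩) {P P' : State} {α : Act} (h : T.Trans P α P') :
    T.Trans (π • P) (π • α) (π • P') := by
  have := Set.smul_mem_smul_set (a := π) h
  rw [T.transitions_equivariant] at this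
  rw [NTS.Trans, T.bn_equivariant]
  exact this

/-- Renaming the binding names of a transition. -/
theorem NTS.Trans.alpha {P P' : State} {α : Act} (h : T.Trans P α P') {σ : NPerm 𝒩}
    (hσ : ∀ a ∈ supp 𝒩 (α, P'), a ∉ T.bn α → σ • a = a) : T.Trans P (σ • α) (σ • P') := by
  have e : NameAbs.mk (T.bn α) (α, P') = NameAbs.mk (T.bn (σ • α)) (σ • α, σ • P') :=
    Quotient.sound ⟨σ, Prod.ext (T.bn_equivariant σ α).symm rfl, hσ⟩
  rw [NTS.Trans, ← e]
  exact h

theorem fresh_bn_smul (ρ : NPerm 𝒩) {X : Type*} [MulAction (NPerm 𝒩) X] {α : Act} {x : X}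
    (h : Fresh (T.bn α) x) : Fresh (T.bn (ρ • α)) (ρ • x) := by
  rw [T.bn_equivariant]
  exact (fresh_smul_iff ρ _ x).2 h

/-- All ingredients of the semantics are equivariant. In the action clause the renamings `σ`
correspond under conjugation by `ρ`, the successors under `ρ` itself, and `hL` matches the indices.
-/
theorem RawFormula.sat_smul_iff (hL : L.Equivariant) (ρ : NPerm 𝒩)
    {A : RawFormula κ ℱ.Effect Pred Act} {π : NPerm 𝒩} {F : Pfs 𝒩 ℱ.Effect} {P : State} :
    A.Sat T L (ρ * π) (ρ • F) (ρ • P) ↔ A.Sat T L π F P := by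
  induction A generalizing π F P with
  | conj I hI A ih => exact forall_congr' fun i => ih i
  | neg A ih => exact not_congr ih
  | pred f φ =>
    simp only [RawFormula.Sat, mul_smul, EffectSet.Effect.smul_apply_smul,
      T.entails_equivariant]
  | act f α A ih =>
    refine ((MulAut.conj ρ).toEquiv.exists_congr fun σ => ?_).symm
    have hσ : (MulAut.conj ρ).toEquiv σ = ρ * σ * ρ⁻¹ := rfl
    rw [hσ]
    have e : ρ * σ * ρ⁻¹ * (ρ * π) = ρ * (σ * π) := by group
    simp only [← mul_smul, e]
    rw [mul_smul ρ (σ * π) α, mul_smul ρ π f, mul_smul ρ π α, mul_smul ρ π (A.toFormula T),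
      EffectSet.Effect.smul_apply_smul, T.bn_equivariant ρ ((σ * π) • α), fresh_smul_iff,
      fresh_smul_iff, fresh_smul_iff, T.bn_equivariant ρ (π • α)]
    refine and_congr ?_ (and_congr_right fun _ => and_congr_right fun _ =>
      and_congr_right fun _ => ?_)
    · constructor
      · intro H a ha hb
        obtain ⟨b, rfl⟩ : ∃ b, ρ • b = a := ⟨ρ⁻¹ • a, by simp⟩
        rw [Finset.smul_mem_smul_finset_iff] at hb
        have := H b ((smul_mem_supp_smul ρ b (π • α, π • A.toFormula T)).1 ha) hb
        simp [mul_smul, this]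
      · intro H a ha hb
        have := H (ρ • a) ((smul_mem_supp_smul ρ a (π • α, π • A.toFormula T)).2 ha)
          (fun h => hb ((Finset.smul_mem_smul_finset_iff ρ).1 h))
        simpa [mul_smul] using this
    · refine (MulAction.toPerm ρ).exists_congr fun P' => ?_
      rw [MulAction.toPerm_apply, ← hL, ih]
      refine and_congr_left fun _ => ⟨fun h => h.smul ρ, fun h => ?_⟩
      simpa using h.smul ρ⁻¹

theorem valid_smul_iff (hL : L.Equivariant) (ρ : NPerm 𝒩) {A : Formula T ℱ κ}
    {F : Pfs 𝒩 ℱ.Effect} {P : State} :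
    Valid L (ρ • F) (ρ • P) (ρ • A) ↔ Valid L F P A := by
  obtain ⟨A⟩ := A
  change (ρ • A).Sat T L 1 (ρ • F) (ρ • P) ↔ A.Sat T L 1 F P
  rw [RawFormula.sat_smul, one_mul, ← RawFormula.sat_smul_iff hL ρ (π := 1), mul_one]

theorem IsFLFormula.smul (hL : L.Equivariant) {F : Pfs 𝒩 ℱ.Effect} {A : Formula T ℱ κ}
    (h : IsFLFormula L F A) (ρ : NPerm 𝒩) : IsFLFormula L (ρ • F) (ρ • A) := by
  induction h with
  | conj I hI A _ hA ih => exact .conj I hI (fun i => ρ • A i) ih (hA.range_smul ρ)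
  | neg A _ ih => exact .neg _ ih
  | pred f φ hf => exact .pred _ _ (Pfs.smul_mem_smul ρ hf)
  | act f α A hf h1 h2 _ ih =>
    rw [hL] at ih
    exact .act _ _ _ (Pfs.smul_mem_smul ρ hf) (fresh_bn_smul ρ h1) (fresh_bn_smul ρ h2) ih

/-- A permutation that leaves the set of conjuncts invariant fixes the conjunction. -/
theorem smul_conj_eq {I : Set κ.out} {hI : #I < κ} {A : I → RawFormula κ ℱ.Effect Pred Act}
    {ρ : NPerm 𝒩}
    (h : ρ • (Set.range fun i => (A i).toFormula T) = Set.range fun i => (A i).toFormula T) :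
    ρ • (RawFormula.conj I hI A).toFormula T = (RawFormula.conj I hI A).toFormula T := by
  have h1 : ∀ i, ∃ j, (A j).toFormula T = ρ • (A i).toFormula T := fun i => by
    have : ρ • (A i).toFormula T ∈ Set.range fun i => (A i).toFormula T := by
      rw [← h]
      exact Set.smul_mem_smul_set ⟨i, rfl⟩
    exact this
  have h2 : ∀ j, ∃ i, ρ • (A i).toFormula T = (A j).toFormula T := fun j => by
    have : (A j).toFormula T ∈ ρ • Set.range fun i => (A i).toFormula T := by
      rw [h]
      exact ⟨j, rfl⟩
    obtain ⟨_, ⟨i, rfl⟩, e⟩ := this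
    exact ⟨i, e⟩
  choose g hg using h1
  choose k hk using h2
  exact Quotient.sound (.conj g k (fun i => Quotient.exact (hg i).symm)
    fun j => Quotient.exact (hk j))

/-- Not automatic: `Formula` contains arbitrary conjunctions of fewer than `κ` raw formulas, and
only membership in the logic makes each set of conjuncts finitely supported. -/
theorem IsFLFormula.finSupp {F : Pfs 𝒩 ℱ.Effect} {A : Formula T ℱ κ}
    (h : IsFLFormula L F A) : FinSupp 𝒩 A := by
  induction h with
  | conj I hI A _ hA _ =>
    obtain ⟨S, hS⟩ := hA
    exact ⟨S, fun π hπ => smul_conj_eq (hS π hπ)⟩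
  | neg A _ ih =>
    obtain ⟨S, hS⟩ := ih
    exact ⟨S, fun π hπ => Quotient.sound (.neg (Quotient.exact (hS π hπ)))⟩
  | pred f φ hf =>
    obtain ⟨S, hS⟩ := FinSupp.prod (Nominal.finSupp (𝒩 := 𝒩) f) (Nominal.finSupp (𝒩 := 𝒩) φ)
    refine ⟨S, fun π hπ => congrArg (RawFormula.toFormula T) ?_⟩
    have := Prod.mk.inj (hS π hπ)
    exact congrArg₂ RawFormula.pred this.1 this.2
  | act f α A hf h1 h2 _ ih =>
    obtain ⟨S, hS⟩ := FinSupp.prod (Nominal.finSupp (𝒩 := 𝒩) f)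
      (FinSupp.prod (Nominal.finSupp (𝒩 := 𝒩) α) ih)
    refine ⟨S, fun π hπ => ?_⟩
    have e1 : π • f = f := congrArg Prod.fst (hS π hπ)
    have e2 : π • α = α := congrArg (fun p => p.2.1) (hS π hπ)
    have e3 : π • A.toFormula T = A.toFormula T := congrArg (fun p => p.2.2) (hS π hπ)
    change (RawFormula.act (π • f) (π • α) (π • A)).toFormula T = _
    rw [e1, e2]
    exact Quotient.sound (.act (Quotient.exact e3))

/-- Transporting a bisimulation along `ρ` makes bisimilarity invariant under permutations, so that a
renaming of binding names can later be undone. -/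
theorem IsLBisimulation.smul (hL : L.Equivariant) {R : Pfs 𝒩 ℱ.Effect → State → State → Prop}
    (hR : IsLBisimulation T L R) (ρ : NPerm 𝒩) :
    IsLBisimulation T L fun F P Q => R (ρ • F) (ρ • P) (ρ • Q) where
  symm F P Q h := hR.symm _ _ _ h
  static F P Q h f hf φ hφ := by
    have := hR.static _ _ _ h (ρ • f) (Pfs.smul_mem_smul ρ hf) (ρ • φ)
    simp only [EffectSet.Effect.smul_apply_smul, T.entails_equivariant] at this
    exact this hφ
  simulation F P Q h f hf α P' h1 h2 h3 := by
    obtain ⟨Q', hQ'⟩ := hR.simulation _ _ _ h (ρ • f) (Pfs.smul_mem_smul ρ hf) (ρ • α) (ρ • P')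
      (by rw [EffectSet.Effect.smul_apply_smul]; exact fresh_bn_smul ρ h1)
      (fresh_bn_smul ρ h2) (fresh_bn_smul ρ h3)
    simp only [EffectSet.Effect.smul_apply_smul] at hQ'
    refine ⟨ρ⁻¹ • Q', fun ht => ?_⟩
    obtain ⟨h4, h5⟩ := hQ' (ht.smul ρ)
    refine ⟨by simpa using h4.smul ρ⁻¹, ?_⟩
    rwa [hL, smul_inv_smul]

theorem FLBisimilar.symm {F : Pfs 𝒩 ℱ.Effect} {P Q : State} (h : FLBisimilar T L F P Q) :
    FLBisimilar T L F Q P := by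
  obtain ⟨R, hR, h⟩ := h
  exact ⟨R, hR, hR.symm _ _ _ h⟩

theorem FLBisimilar.of_smul (hL : L.Equivariant) {ρ : NPerm 𝒩} {F : Pfs 𝒩 ℱ.Effect}
    {P Q : State} (h : FLBisimilar T L (ρ • F) (ρ • P) (ρ • Q)) : FLBisimilar T L F P Q := by
  obtain ⟨R, hR, h⟩ := h
  exact ⟨_, hR.smul hL ρ, h⟩

/-! ### Renaming in formulas with an action modality -/

/-- A renaming of the binding names provides a witness for the validity of `⟨f⟩⟨α⟩A`. -/
theorem valid_act_of_smul {F : Pfs 𝒩 ℱ.Effect} {P P' : State} {f : ℱ.Effect} {α : Act}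
    {A : RawFormula κ ℱ.Effect Pred Act} {σ : NPerm 𝒩}
    (hσ : ∀ a ∈ supp 𝒩 (α, A.toFormula T), a ∉ T.bn α → σ • a = a)
    (hP : Fresh (T.bn (σ • α)) (f P)) (hF : Fresh (T.bn (σ • α)) F)
    (hf : Fresh (T.bn (σ • α)) f) (ht : T.Trans (f P) (σ • α) P')
    (hv : Valid L (L (σ • α) F f) P' (σ • A.toFormula T)) :
    Valid L F P ((RawFormula.act f α A).toFormula T) :=
  (valid_act L F P f α A).2 ⟨σ • α, σ • A,
    Quotient.sound ⟨σ, Prod.ext (T.bn_equivariant σ α).symm rfl, hσ⟩, hP, hF, hf, P', ht, hv⟩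

/-- The witness for the validity of `⟨f⟩⟨α⟩A` can be chosen with binding names that avoid a given
finite set, using a renaming that moves only old and new binding names. -/
theorem exists_smul_of_valid_act (hL : L.Equivariant) {F : Pfs 𝒩 ℱ.Effect} {P : State}
    {f : ℱ.Effect} {α : Act} {A : RawFormula κ ℱ.Effect Pred Act}
    (hA : FinSupp 𝒩 (A.toFormula T)) (h : Valid L F P ((RawFormula.act f α A).toFormula T))
    {C : Set 𝒩} (hC : C.Finite) :
    ∃ (ρ : NPerm 𝒩) (P' : State), (∀ a, a ∉ T.bn α → a ∉ T.bn (ρ • α) → ρ • a = a) ∧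
      (∀ a ∈ T.bn (ρ • α), a ∉ C) ∧ T.Trans (f P) (ρ • α) P' ∧
      Valid L (L (ρ • α) F f) P' (ρ • A.toFormula T) := by
  obtain ⟨α', A', e, hP, hF, hf, P', ht, hv⟩ := (valid_act L F P f α A).1 h
  obtain ⟨τ, hτ, hfix⟩ := Quotient.exact e
  obtain rfl : τ • α = α' := congrArg (fun p => p.2.1) hτ
  rw [← show τ • A.toFormula T = A'.toFormula T from congrArg (fun p => p.2.2) hτ] at hv
  have hpair : FinSupp 𝒩 (α, A.toFormula T) := (Nominal.finSupp α).prod hA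
  -- The binding names of the given witness may meet `C`. They are fresh for `f P`, `F` and `f`, so
  -- a `σ` moving them away can fix these three and carry the transition and the validity along.
  obtain ⟨σ, h1, h2⟩ := exists_perm_avoiding (T.bn (τ • α))
    (C := C ∪ supp 𝒩 (τ • (α, A.toFormula T)) ∪ supp 𝒩 F ∪ supp 𝒩 f ∪ supp 𝒩 (f P))
    ((((hC.union (hpair.smul τ).finite_supp).union (finite_supp F)).union
      (finite_supp f)).union (finite_supp (f P)))
  simp only [Set.mem_union, not_or] at h1 h2
  have hσP : σ • f P = f P := smul_eq_of_forall_supp fun a ha =>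
    h2 a (by simp [ha]) fun hb => hP a hb ha
  have hσF : σ • F = F := smul_eq_of_forall_supp fun a ha =>
    h2 a (by simp [ha]) fun hb => hF a hb ha
  have hσf : σ • f = f := smul_eq_of_forall_supp fun a ha =>
    h2 a (by simp [ha]) fun hb => hf a hb ha
  -- `σ * τ` may move names that are neither old nor new binding names. `ρ` discards these movements
  -- and still acts in the same way on `(α, A)`, because both fix the free names of that pair.
  obtain ⟨ρ, h3, h4⟩ := exists_perm_eqOn (σ * τ) (T.bn α)
  have hbn : (σ * τ) • T.bn α = σ • T.bn (τ • α) := by rw [mul_smul, T.bn_equivariant]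
  have havoid : ∀ a ∈ (σ * τ) • T.bn α, a ∉ C ∧ a ∉ supp 𝒩 (τ • (α, A.toFormula T)) := by
    intro a ha
    rw [hbn] at ha
    obtain ⟨b, hb, rfl⟩ := Finset.mem_smul_finset.1 ha
    exact (h1 b hb).1.1.1
  have hρ : ρ • (α, A.toFormula T) = (σ * τ) • (α, A.toFormula T) := by
    refine hpair.smul_eq_smul fun a ha => ?_
    by_cases hb : a ∈ T.bn α
    · exact h3 a hb
    have hτa : τ • a = a := hfix a ha hb
    have ha' : a ∈ supp 𝒩 (τ • (α, A.toFormula T)) := by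
      have := (smul_mem_supp_smul τ a (α, A.toFormula T)).2 ha
      rwa [hτa] at this
    rw [h4 a hb fun h => (havoid a h).2 ha', mul_smul, hτa]
    refine (h2 a (Or.inl (Or.inl (Or.inl (Or.inr ha')))) fun h => hb ?_).symm
    rwa [← hτa, T.bn_equivariant, Finset.smul_mem_smul_finset_iff] at h
  have e1 : ρ • α = σ • τ • α := (congrArg Prod.fst hρ).trans (mul_smul σ τ α)
  have e2 : ρ • A.toFormula T = σ • τ • A.toFormula T :=
    (congrArg Prod.snd hρ).trans (mul_smul σ τ (A.toFormula T))
  have e3 : T.bn (ρ • α) = (σ * τ) • T.bn α := by rw [e1, hbn, T.bn_equivariant]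
  refine ⟨ρ, σ • P', fun a ha ha' => h4 a ha (e3 ▸ ha'), fun a ha => (havoid a (e3 ▸ ha)).1,
    ?_, ?_⟩
  · rw [e1, ← hσP]
    exact ht.smul σ
  · have := (valid_smul_iff hL σ).2 hv
    rwa [hL, hσF, hσf, ← e1, ← e2] at this

/-! ### Bisimilar states satisfy the same formulas -/

theorem IsFLFormula.valid_of_bisimilar (hL : L.Equivariant) {F : Pfs 𝒩 ℱ.Effect}
    {A : Formula T ℱ κ} (h : IsFLFormula L F A) {P Q : State} (hPQ : FLBisimilar T L F P Q)
    (hP : Valid L F P A) : Valid L F Q A := by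
  induction h generalizing P Q with
  | conj I hI A _ _ ih => exact fun i => ih i hPQ (hP i)
  | neg A _ ih => exact fun hQ => hP (ih hPQ.symm hQ)
  | pred f φ hf =>
    obtain ⟨R, hR, h⟩ := hPQ
    rw [valid_pred] at hP ⊢
    exact hR.static _ _ _ h f hf φ hP
  | @act F f α A hf h1 h2 hA ih =>
    -- Avoiding `f Q`, `F` and `f` meets the side conditions of the simulation clause; avoiding the
    -- support of `(α, A)` makes `ρ` an admissible alpha-renaming.
    obtain ⟨ρ, P', h3, h4, ht, hv⟩ := exists_smul_of_valid_act hL hA.finSupp hP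
      (C := supp 𝒩 (α, A.toFormula T) ∪ supp 𝒩 F ∪ supp 𝒩 f ∪ supp 𝒩 (f Q))
      ((((FinSupp.prod (Nominal.finSupp α) hA.finSupp).finite_supp.union (finite_supp F)).union
        (finite_supp f)).union (finite_supp (f Q)))
    simp only [Set.mem_union, not_or] at h4
    have hfF : Fresh (T.bn (ρ • α)) F := fun a ha => (h4 a ha).1.1.2
    have hff : Fresh (T.bn (ρ • α)) f := fun a ha => (h4 a ha).1.2
    have hfQ : Fresh (T.bn (ρ • α)) (f Q) := fun a ha => (h4 a ha).2
    obtain ⟨R, hR, h⟩ := hPQ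
    obtain ⟨Q', hQ'⟩ := hR.simulation _ _ _ h f hf (ρ • α) P' hfQ hfF hff
    obtain ⟨ht', h'⟩ := hQ' ht
    have hb : FLBisimilar T L (L (ρ • α) F f) P' Q' := ⟨R, hR, h'⟩
    refine valid_act_of_smul (fun a ha ha' => h3 a ha' fun hn => (h4 a hn).1.1.1 ha)
      hfQ hfF hff ht' ?_
    have e : L (ρ • α) F f = ρ • L α F f := by
      rw [hL, smul_eq_of_fresh h3 h2 hfF, smul_eq_of_fresh h3 h1 hff]
    rw [e] at hb hv ⊢
    -- The induction hypothesis concerns `A` at index `L α F f`, not `ρ • A`, so it is applied to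
    -- `ρ⁻¹ • P'` and `ρ⁻¹ • Q'`.
    rw [← smul_inv_smul ρ Q', valid_smul_iff hL]
    refine ih (P := ρ⁻¹ • P') (FLBisimilar.of_smul hL (ρ := ρ) (by simpa using hb)) ?_
    rwa [← valid_smul_iff hL ρ, smul_inv_smul]

/-! ### Distinguishing formulas -/

/-- Conjunction of a finitely supported family of fewer than `κ` formulas, supported by whatever
leaves the family invariant. -/
theorem exists_conj {ι : Type*} {F : Pfs 𝒩 ℱ.Effect}
    (hι : Cardinal.lift.{v} #ι < Cardinal.lift κ) (B : ι → Formula T ℱ κ)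
    (hB : ∀ i, IsFLFormula L F (B i)) (hfin : FinSupp 𝒩 (Set.range B)) :
    ∃ C : Formula T ℱ κ, IsFLFormula L F C ∧ (∀ P, Valid L F P C ↔ ∀ i, Valid L F P (B i)) ∧
      ∀ ρ : NPerm 𝒩, ρ • Set.range B = Set.range B → ρ • C = C := by
  -- Raw conjunctions are indexed by subsets of `κ.out`; the image of `ι` under an embedding serves
  -- as the index set.
  obtain ⟨g⟩ : Nonempty (ι ↪ κ.out) := by
    rw [← Cardinal.lift_mk_le', Cardinal.mk_out]
    exact hι.le
  let e : ι ≃ Set.range g := Equiv.ofInjective g g.injective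
  have hI : #(Set.range g) < κ := by
    have := Cardinal.lift_mk_eq'.2 ⟨e⟩
    rw [this] at hι
    exact Cardinal.lift_lt.1 hι
  choose A hA using fun i => Quotient.exists_rep (B i)
  change ∀ i, (A i).toFormula T = B i at hA
  have hr : (Set.range fun i => (A (e.symm i)).toFormula T) = Set.range B := by
    simp only [hA]
    exact e.symm.surjective.range_comp B
  refine ⟨(RawFormula.conj (Set.range g) hI fun i => A (e.symm i)).toFormula T,
    .conj _ _ _ (fun i => ?_) (hr ▸ hfin), fun P => ?_, fun ρ hρ => smul_conj_eq (hr ▸ hρ)⟩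
  · rw [hA]
    exact hB _
  · rw [valid_conj]
    simp only [hA]
    exact e.symm.forall_congr_right (q := fun i => Valid L F P (B i))

theorem exists_distinguishing {F : Pfs 𝒩 ℱ.Effect} {P Q : State}
    (h : ¬ FLLogEquiv T L κ F P Q) :
    ∃ A : Formula T ℱ κ, IsFLFormula L F A ∧ Valid L F P A ∧ ¬ Valid L F Q A := by
  simp only [FLLogEquiv, not_forall] at h
  obtain ⟨A, hA, h⟩ := h
  by_cases hP : Valid L F P A
  · exact ⟨A, hA, hP, fun hQ => h (iff_of_true hP hQ)⟩
  · obtain ⟨A, rfl⟩ := Quotient.exists_rep A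
    refine ⟨(RawFormula.neg A).toFormula T, .neg A hA, hP, fun hQ => h (iff_of_false hP hQ)⟩

/-- A distinguishing formula can be chosen to be supported by the support of `F` and of the
state that satisfies it. -/
theorem exists_distinguishing_supports (hL : L.Equivariant) (hκ : ℵ₀ < κ)
    {F : Pfs 𝒩 ℱ.Effect} {P Q : State} (h : ¬ FLLogEquiv T L κ F P Q) :
    ∃ A : Formula T ℱ κ, IsFLFormula L F A ∧ Valid L F P A ∧ ¬ Valid L F Q A ∧
      Supports (supp 𝒩 (F, P)) A := by
  obtain ⟨A, hA, hP, hQ⟩ := exists_distinguishing h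
  -- The new formula is the conjunction of the `π • A` with `π ∈ G`. Its conjuncts remain in the
  -- logic at `F` and true at `P` since `π` fixes both, and it fails at `Q` because `1 ∈ G`.
  let G := {π : NPerm 𝒩 // ∀ a ∈ supp 𝒩 (F, P), π • a = a}
  have hG : ∀ π : G, π.1 • F = F ∧ π.1 • P = P := fun π =>
    ⟨smul_eq_of_forall_supp fun a ha => π.2 a (supp_subset_supp_prod_left F P ha),
      smul_eq_of_forall_supp fun a ha => π.2 a (supp_subset_supp_prod_right F P ha)⟩
  have hinv : ∀ ρ : NPerm 𝒩, (∀ a ∈ supp 𝒩 (F, P), ρ • a = a) →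
      ρ • (Set.range fun π : G => π.1 • A) = Set.range fun π : G => π.1 • A := by
    intro ρ hρ
    rw [← Set.image_smul, ← Set.range_comp]
    -- Left multiplication by `ρ` permutes `G`, so the orbit of `A` is invariant.
    let e : G ≃ G :=
      { toFun := fun π => ⟨ρ * π.1, fun a ha => by rw [mul_smul, π.2 a ha, hρ a ha]⟩
        invFun := fun π => ⟨ρ⁻¹ * π.1, fun a ha => by
          rw [mul_smul, π.2 a ha, inv_smul_eq_iff, hρ a ha]⟩
        left_inv := fun π => Subtype.ext (inv_mul_cancel_left ρ π.1)
        right_inv := fun π => Subtype.ext (mul_inv_cancel_left ρ π.1) }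
    rw [← e.surjective.range_comp fun π : G => π.1 • A]
    exact congrArg Set.range (funext fun π => (mul_smul ρ π.1 A).symm)
  have hFP : (supp 𝒩 (F, P)).Finite :=
    ((Nominal.finSupp F).prod (Nominal.finSupp P)).finite_supp
  obtain ⟨C, hC, hCv, hCs⟩ := exists_conj (L := L) (F := F) (κ := κ)
    (lt_of_le_of_lt (Cardinal.lift_le_aleph0.2 (Cardinal.mk_le_aleph0 (α := G)))
      (Cardinal.aleph0_lt_lift.2 hκ)) (fun π : G => π.1 • A)
    (fun π => by
      have := hA.smul hL π.1
      rwa [(hG π).1] at this)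
    ⟨hFP.toFinset, fun ρ hρ => hinv ρ fun a ha => hρ a (by simpa using ha)⟩
  refine ⟨C, hC, (hCv P).2 fun π => ?_, fun hQ' => hQ ?_, fun ρ hρ => hCs ρ (hinv ρ hρ)⟩
  · have := (valid_smul_iff hL π.1).2 hP
    rwa [(hG π).1, (hG π).2] at this
  · have := (hCv Q).1 hQ' ⟨1, by simp⟩
    simpa using this

/-! ### Logical equivalence is a bisimulation -/

theorem isLBisimulation_logEquiv (hL : L.Equivariant) (hκ : ℵ₀ < κ) (hκS : #State < κ) :
    IsLBisimulation T L (FLLogEquiv T L κ) where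
  symm F P Q h A hA := (h A hA).symm
  static F P Q h f hf φ hφ := by
    have := h _ (.pred f φ hf)
    rw [valid_pred, valid_pred] at this
    exact this.1 hφ
  simulation F P Q h f hf α P' h1 h2 h3 := by
    by_contra hn
    push Not at hn
    -- The choice of `Q'` precedes the implication in the simulation clause, so its negation yields
    -- this transition at every state; `P'` is just an available instance.
    have ht : T.Trans (f P) α P' := (hn P').1
    let D := {Q' : State // T.Trans (f Q) α Q'}
    choose B hB hBP hBQ hBs using fun Q' : D =>
      exists_distinguishing_supports hL hκ ((hn Q'.1).2 Q'.2)
    have hsupp : (supp 𝒩 (L α F f, P')).Finite :=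
      ((Nominal.finSupp (L α F f)).prod (Nominal.finSupp P')).finite_supp
    -- The support of `(L α F f, P')` does not depend on `Q'` and supports every `B Q'`.
    have hfin : FinSupp 𝒩 (Set.range B) := by
      refine ⟨hsupp.toFinset, fun ρ hρ => ?_⟩
      rw [← Set.image_smul, ← Set.range_comp]
      exact congrArg Set.range (funext fun Q' =>
        hBs Q' ρ fun a ha => hρ a (by simpa using ha))
    obtain ⟨C, hC, hCv, -⟩ := exists_conj (L := L) (κ := κ)
      (Cardinal.lift_lt.2 ((Cardinal.mk_subtype_le _).trans_lt hκS)) B hB hfin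
    obtain ⟨C, rfl⟩ := Quotient.exists_rep C
    change IsFLFormula L (L α F f) (C.toFormula T) at hC
    have hCP : Valid L (L α F f) P' (C.toFormula T) := (hCv P').2 hBP
    have hpair : FinSupp 𝒩 (α, C.toFormula T) := (Nominal.finSupp α).prod hC.finSupp
    -- The names of `bn α` are fresh for `f Q` but perhaps not for `f P`, so the transition to `P'`
    -- is first alpha-renamed.
    have hPv : Valid L F P ((RawFormula.act f α C).toFormula T) := by
      obtain ⟨σ, h4, h5⟩ := exists_perm_avoiding (T.bn α)
        (C := supp 𝒩 (α, C.toFormula T) ∪ supp 𝒩 (α, P') ∪ supp 𝒩 F ∪ supp 𝒩 f ∪ supp 𝒩 (f P))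
        ((((hpair.finite_supp.union
          ((Nominal.finSupp α).prod (Nominal.finSupp P')).finite_supp).union
          (finite_supp F)).union (finite_supp f)).union (finite_supp (f P)))
      simp only [Set.mem_union, not_or] at h4 h5
      have hbn : ∀ a ∈ T.bn (σ • α), ∃ b ∈ T.bn α, σ • b = a := fun a ha => by
        rw [T.bn_equivariant] at ha
        exact Finset.mem_smul_finset.1 ha
      have hσF : σ • F = F := smul_eq_of_forall_supp fun a ha =>
        h5 a (by simp [ha]) fun hb => h2 a hb ha
      have hσf : σ • f = f := smul_eq_of_forall_supp fun a ha =>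
        h5 a (by simp [ha]) fun hb => h3 a hb ha
      refine valid_act_of_smul (σ := σ) (P' := σ • P') (fun a ha => h5 a (by simp [ha])) ?_ ?_ ?_
        (ht.alpha fun a ha => h5 a (by simp [ha])) ?_
      · intro a ha
        obtain ⟨b, hb, rfl⟩ := hbn a ha
        exact (h4 b hb).2
      · intro a ha
        obtain ⟨b, hb, rfl⟩ := hbn a ha
        exact (h4 b hb).1.1.2
      · intro a ha
        obtain ⟨b, hb, rfl⟩ := hbn a ha
        exact (h4 b hb).1.2
      · have := (valid_smul_iff hL σ).2 hCP
        rwa [hL, hσF, hσf] at this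
    have hQv := (h _ (.act f α C hf h3 h2 hC)).1 hPv
    obtain ⟨ρ, Q', h6, h7, ht', hv⟩ := exists_smul_of_valid_act hL hC.finSupp hQv
      (C := supp 𝒩 F ∪ supp 𝒩 f ∪ supp 𝒩 (f Q))
      (((finite_supp F).union (finite_supp f)).union (finite_supp (f Q)))
    simp only [Set.mem_union, not_or] at h7
    -- Since `bn α` is also fresh for `f Q`, `ρ` fixes `f Q` as well as `F` and `f`. Undoing it
    -- turns the witness into an `α`-successor of `f Q` that satisfies `C`, against its own
    -- conjunct.
    have hρF : ρ • F = F := smul_eq_of_fresh h6 h2 fun a ha => (h7 a ha).1.1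
    have hρf : ρ • f = f := smul_eq_of_fresh h6 h3 fun a ha => (h7 a ha).1.2
    have hρQ : ρ • f Q = f Q := smul_eq_of_fresh h6 h1 fun a ha => (h7 a ha).2
    have ht'' : T.Trans (f Q) α (ρ⁻¹ • Q') := by
      have := ht'.smul ρ⁻¹
      rwa [inv_smul_smul, inv_smul_eq_iff.2 hρQ.symm] at this
    refine hBQ ⟨ρ⁻¹ • Q', ht''⟩ ((hCv _).1 ?_ _)
    change Valid L (L α F f) (ρ⁻¹ • Q') (C.toFormula T)
    rwa [← valid_smul_iff hL ρ, hL, hρF, hρf, smul_inv_smul]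

end Equivariance

end NominalTS

/-! ### Bisimilarity coincides with logical equivalence -/

theorem mainTheorem4 {𝒩 : Type u} [NominalTS.Names 𝒩] [DecidableEq 𝒩]
    {State : Type v} {Pred : Type w} {Act : Type z}
    [NominalTS.Nominal 𝒩 State] [NominalTS.Nominal 𝒩 Pred] [NominalTS.Nominal 𝒩 Act]
    (T : NominalTS.NTS 𝒩 State Pred Act) (ℱ : NominalTS.EffectSet 𝒩 State)
    (L : Act → NominalTS.Pfs 𝒩 ℱ.Effect → ℱ.Effect → NominalTS.Pfs 𝒩 ℱ.Effect)
    (hL : NominalTS.Later.Equivariant L)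
    (κ : Cardinal.{v}) (hκ : Cardinal.aleph0 < κ) (hκS : Cardinal.mk State < κ)
    (F : NominalTS.Pfs 𝒩 ℱ.Effect) (P Q : State) :
    NominalTS.FLBisimilar T L F P Q ↔ NominalTS.FLLogEquiv T L κ F P Q := by
  constructor
  · exact fun h A hA => ⟨hA.valid_of_bisimilar hL h, hA.valid_of_bisimilar hL h.symm⟩
  · exact fun h => ⟨_, NominalTS.isLBisimulation_logEquiv hL hκ hκS, h⟩
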